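/- Let $(\mathsf X,\mathcal X)$ and $(\Theta,\mathcal T)$ be measurable spaces with countably generated $\sigma$-fields, and let $\{P_\theta,\theta\in\Theta\}$ be Markov transition kernels on $\mathsf X$ such that $\theta\mapsto P_\theta(x,A)$ is measurable for all $x\in\mathsf X$, $A\in\mathcal X$. Let $\{\bar P(n;\cdot,\cdot),n\ge 0\}$ be Markov transition kernels on $\mathsf X\times\Theta$ with $\bar P(n;(x,\theta);A\times\Theta)=P_\theta(x,A)$ for all $n\ge0$, $(x,\theta)\in\mathsf X\times\Theta$ and $A\in\mathcal X$. For $l\ge 0$ let $\mathbb E^{(l)}_{x,\theta}$ denote the expectation for the canonical non-homogeneous Markov chain $Z_n=(X_n,\theta_n)$, $n\ge0$, started at $Z_0=(x,\theta)$, whose transition from time $n$ to time $n+1$ is governed by $\bar P(l+n;\cdot,\cdot)$. For probability measures $\xi_1$ on $\mathsf X$ and $\xi_2$ on $\Theta$, let $\mathbb P_{\xi_1,\xi_2}$, $\mathbb E_{\xi_1,\xi_2}$ denote probability and expectation for the chain with $l=0$ and $Z_0\sim\xi_1\otimes\xi_2$. Write $\|\mu\|_{\mathrm{TV}}=\sup_{|f|\le1}|\mu(f)|$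 (supremum over measurable $f:\mathsf X\to\mathbb R$ with $|f|\le 1$), $D(\theta,\theta')=\sup_{x\in\mathsf X}\|P_\theta(x,\cdot)-P_{\theta'}(x,\cdot)\|_{\mathrm{TV}}$, and, for $\mathsf C\subseteq\mathsf X$, $\tau_{\mathsf C}=\inf\{n\ge1: X_n\in\mathsf C\}$ with $\inf\emptyset=\infty$. **Theorem 2.1.** Assume the following. A1. There exist a measurable function $V:\mathsf X\to[1,+\infty)$ and a measurable set $\mathsf C\subseteq\mathsf X$ such that (i) $\sup_{l\ge 0}\sup_{(x,\theta)\in \mathsf C\times\Theta}\mathbb E^{(l)}_{x,\theta}[r(\tau_{\mathsf C})]<+\infty$ for some non-decreasing function $r:\mathbb N\to(0,+\infty)$ with $\sum_n 1/r(n)<+\infty$ (with $r(\infty)=+\infty$); (ii) there exists a probability measure $\pi$ on $\mathsf X$ such that $\displaystyle\lim_{n\to+\infty}\sup_{x\in\mathsf X}V^{-1}(x)\sup_{\theta\in\Theta}\|P_\theta^n(x,\cdot)-\pi\|_{\mathrm{TV}}=0$; (iii) $\sup_{\theta\in\Theta} P_\theta V(x)\le V(x)$ for all $x\notin\mathsf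 C$, and $\sup_{(x,\theta)\in\mathsf C\times\Theta}\{P_\theta V(x)+V(x)\}<+\infty$. B1. There exist probability measures $\xi_1$ on $\mathsf X$ and $\xi_2$ on $\Theta$ such that for every $\epsilon>0$, $\lim_{n\to+\infty}\mathbb P_{\xi_1,\xi_2}\big(D(\theta_n,\theta_{n-1})\ge\epsilon\big)=0$ (outer probability, should the event not be measurable). Then, for these $\pi,\xi_1,\xi_2$, $$\lim_{n\to+\infty}\ \sup_{|f|\le1}\big|\mathbb E_{\xi_1,\xi_2}[f(X_n)-\pi(f)]\big|=0,$$ where the supremum is over measurable functions $f:\mathsf X\to\mathbb R$ with $|f|\le1$; that is, the law of $X_n$ under $\mathbb P_{\xi_1,\xi_2}$ converges to $\pi$ in total variation. -/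

import Mathlib

open MeasureTheory ProbabilityTheory Filter Topology
open scoped ENNReal

noncomputable section

namespace AdaptiveMCMC

variable {X Θ : Type*} [MeasurableSpace X] [MeasurableSpace Θ]

/-- The total variation norm `‖μ - ν‖_TV = sup_{|f|₁ ≤ 1} |μ(f) - ν(f)|` of the difference of two
finite measures, the supremum being over measurable functions `f` bounded by `1` (so its values
lie in `[0, 2]` for probability measures). -/
def tvNorm (μ ν : Measure X) : ℝ≥0∞ :=
  ⨆ (f : X → ℝ) (_ : Measurable f) (_ : ∀ x, |f x| ≤ 1),
    ENNReal.ofReal |∫ x, f x ∂μ - ∫ x, f x ∂ν|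

/-- `D(θ, θ') = sup_x ‖P_θ(x, ·) - P_θ'(x, ·)‖_TV`. -/
def kernelDist (P : Θ → Kernel X X) (θ θ' : Θ) : ℝ≥0∞ :=
  ⨆ x : X, tvNorm (P θ x) (P θ' x)

/-- The kernel from the history up to time `n` to the state at time `n + 1` which applies the
transition kernel `Pbar (l + n)` to the state at time `n`. -/
def stepKernel (Pbar : ℕ → Kernel (X × Θ) (X × Θ)) (l n : ℕ) :
    Kernel (Finset.Iic n → X × Θ) (X × Θ) :=
  (Pbar (l + n)).comap (fun h => h ⟨n, Finset.mem_Iic.2 le_rfl⟩) (measurable_pi_apply _)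

instance (Pbar : ℕ → Kernel (X × Θ) (X × Θ)) [∀ n, IsMarkovKernel (Pbar n)] (l n : ℕ) :
    IsMarkovKernel (stepKernel Pbar l n) := by
  unfold stepKernel
  infer_instance

/-- The law, on the canonical space of trajectories `ω = (Z_n)_n = ((X_n, θ_n))_n`, of the
non-homogeneous Markov chain with initial distribution `μ` and transition kernels
`Pbar (l + n)`, `n ≥ 0`. -/
def chainLaw (Pbar : ℕ → Kernel (X × Θ) (X × Θ)) [∀ n, IsMarkovKernel (Pbar n)]
    (l : ℕ) (μ : Measure (X × Θ)) : Measure (ℕ → X × Θ) :=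
  Kernel.trajMeasure (X := fun _ => X × Θ) μ (fun n => stepKernel Pbar l n)

/-- The return time `τ_C = inf {n ≥ 1 : X_n ∈ C}`, with `inf ∅ = ∞`. -/
def returnTime (C : Set X) (ω : ℕ → X × Θ) : ℕ∞ :=
  ⨅ (n : ℕ) (_ : 1 ≤ n ∧ (ω n).1 ∈ C), (n : ℕ∞)

/-- The extension of `r : ℕ → (0, ∞)` to `ℕ ∪ {∞}` by `r(∞) = ∞`. (This is `lim r(n)` for
the functions of interest, since `∑ 1 / r(n) < ∞`.) -/
def extendRate (r : ℕ → ℝ) : ℕ∞ → ℝ≥0∞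
  | ⊤ => ∞
  | (n : ℕ) => ENNReal.ofReal (r n)

end AdaptiveMCMC

end

/-! Freeze the parameter at time `n`: replacing the kernels used at times `n, …, n + N - 1` by `P
θ_n`, one at a time, changes `E f(X_{n+N})` into `E (P_{θ_n}^N f)(X_n)`. Each replacement costs at
most `D(θ_{n+i}, θ_n)`, which tends to `0` in probability for fixed `i`
(`eventually_abs_integral_pow_sub_le`). Ergodicity makes `P_{θ_n}^N f(X_n)` close to `π(f)`,
uniformly in `f` and `θ_n` on `{V(X_n) ≤ M + 1}`, so it remains to see that `V(X_n)` is bounded in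
probability (`tendsto_iSup_abs_integral`).

The drift condition only says that `V` does not increase in mean off `C`, so tightness needs the
return times (`exists_measure_lt_le`). Split `{V(X_n) > m}` by the last visit to `C`. If it was `j`
steps ago, the contribution is at most `B / m` (drift and Markov) and at most `R / r(j)` (tail of
the return time). Since `∑ 1 / r(j)` converges, `∑ min(B / m, R / r(j))` tends to `0` as `m → ∞` by
dominated convergence, whatever `n` is. -/

noncomputable section

namespace AdaptiveMCMC


/-! ### Expectations for the chain killed on leaving a set. -/

section Taboo

variable {X Θ : Type*} [MeasurableSpace X] [MeasurableSpace Θ]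

/-- `taboo Pbar S h l j z` is the expectation of `h (Z_j)` on the event that `Z_1, …, Z_j` all
lie in `S`, for the chain started at `z` at time `l`. -/
def taboo (Pbar : ℕ → Kernel (X × Θ) (X × Θ)) (S : Set (X × Θ)) (h : X × Θ → ℝ≥0∞) :
    ℕ → ℕ → X × Θ → ℝ≥0∞
  | _, 0 => h
  | l, j + 1 => fun z => ∫⁻ y, S.indicator (taboo Pbar S h (l + 1) j) y ∂Pbar l z

variable {Pbar : ℕ → Kernel (X × Θ) (X × Θ)} {S : Set (X × Θ)} {h : X × Θ → ℝ≥0∞}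

lemma measurable_taboo (hS : MeasurableSet S) (hh : Measurable h) (l j : ℕ) :
    Measurable (taboo Pbar S h l j) := by
  induction j generalizing l with
  | zero => exact hh
  | succ j ih => exact ((ih (l + 1)).indicator hS).lintegral_kernel

lemma taboo_mono {h' : X × Θ → ℝ≥0∞} (hle : h ≤ h') (l j : ℕ) :
    taboo Pbar S h l j ≤ taboo Pbar S h' l j := by
  induction j generalizing l with
  | zero => exact hle
  | succ j ih => exact fun z => lintegral_mono (Set.indicator_mono (ih (l + 1)))

lemma taboo_const_mul (hS : MeasurableSet S) (hh : Measurable h) (c : ℝ≥0∞) (l j : ℕ)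
    (z : X × Θ) : taboo Pbar S (fun z => c * h z) l j z = c * taboo Pbar S h l j z := by
  induction j generalizing l z with
  | zero => rfl
  | succ j ih =>
    simp only [taboo]
    rw [← lintegral_const_mul _ ((measurable_taboo hS hh _ _).indicator hS)]
    refine lintegral_congr fun y => ?_
    by_cases hy : y ∈ S <;> simp [hy, ih]

end Taboo

/-- Pathwise Markov inequality: if `C` is avoided at times `1, …, j`, then `τ_C ≥ j` and `r` is
monotone; otherwise the product vanishes. -/
lemma ofReal_mul_prod_le_extendRate {X Θ : Type*} {C : Set X} {r : ℕ → ℝ} (hr : Monotone r) (j : ℕ)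
    (ω : ℕ → X × Θ) :
    ENNReal.ofReal (r j) *
        ∏ i ∈ Finset.range j, (Prod.fst ⁻¹' Cᶜ : Set (X × Θ)).indicator 1 (ω (1 + i)) ≤
      extendRate r (returnTime C ω) := by
  by_cases hω : ∀ i < j, (ω (1 + i)).1 ∉ C
  · have hprod : ∏ i ∈ Finset.range j,
        (Prod.fst ⁻¹' Cᶜ : Set (X × Θ)).indicator (1 : X × Θ → ℝ≥0∞) (ω (1 + i)) = 1 := by
      refine Finset.prod_eq_one fun i hi => ?_
      simp [hω i (Finset.mem_range.1 hi)]
    have hj : (j : ℕ∞) ≤ returnTime C ω := by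
      refine le_iInf₂ fun n hn => ?_
      by_contra hlt
      have hlt : n < j := by simpa using hlt
      refine hω (n - 1) (by omega) ?_
      rw [Nat.add_sub_cancel' hn.1]
      exact hn.2
    rw [hprod, mul_one]
    cases hτ : returnTime C ω with
    | top => exact le_top
    | coe m =>
      rw [hτ] at hj
      exact ENNReal.ofReal_le_ofReal (hr (by exact_mod_cast hj))
  · push Not at hω
    obtain ⟨i, hi, hC⟩ := hω
    rw [Finset.prod_eq_zero (Finset.mem_range.2 hi) (by simp [hC]), mul_zero]
    exact zero_le

/-! ### Markov property of the chain and last-exit decomposition. -/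

section Chain

variable {X Θ : Type*} [MeasurableSpace X] [MeasurableSpace Θ]
  (Pbar : ℕ → Kernel (X × Θ) (X × Θ)) [∀ n, IsMarkovKernel (Pbar n)]

instance (l : ℕ) (μ : Measure (X × Θ)) [IsProbabilityMeasure μ] :
    IsProbabilityMeasure (chainLaw Pbar l μ) := by
  unfold chainLaw
  infer_instance

/-- The one-step Markov property of the adaptive chain. -/
lemma map_chainLaw_compProd (l n : ℕ) (μ : Measure (X × Θ)) [IsProbabilityMeasure μ] :
    (chainLaw Pbar l μ).map (fun ω => (Preorder.frestrictLe n ω, ω (n + 1))) =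
      (chainLaw Pbar l μ).map (Preorder.frestrictLe n) ⊗ₘ stepKernel Pbar l n :=
  (Kernel.map_frestrictLe_trajMeasure_compProd_eq_map_trajMeasure (X := fun _ => X × Θ)).symm

lemma map_zero_chainLaw (l : ℕ) (μ : Measure (X × Θ)) [IsProbabilityMeasure μ] :
    (chainLaw Pbar l μ).map (fun ω => ω 0) = μ := by
  unfold chainLaw Kernel.trajMeasure
  have h : (fun ω : ℕ → X × Θ => ω 0) =
      (fun h : Finset.Iic 0 → X × Θ => h ⟨0, Finset.mem_Iic.2 le_rfl⟩) ∘
        Preorder.frestrictLe (π := fun _ => X × Θ) 0 := rfl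
  rw [h, ← Measure.map_map (by fun_prop) (by fun_prop), Measure.map_comp _ _ (by fun_prop),
    Kernel.traj_map_frestrictLe, Kernel.partialTraj_self, Measure.id_comp,
    Measure.map_map (by fun_prop) (by fun_prop)]
  exact Measure.map_id

lemma lintegral_chainLaw_succ (l n : ℕ) (μ : Measure (X × Θ)) [IsProbabilityMeasure μ]
    {F : (Finset.Iic n → X × Θ) × (X × Θ) → ℝ≥0∞} (hF : Measurable F) :
    ∫⁻ ω, F (Preorder.frestrictLe n ω, ω (n + 1)) ∂chainLaw Pbar l μ =
      ∫⁻ ω, ∫⁻ y, F (Preorder.frestrictLe n ω, y) ∂Pbar (l + n) (ω n) ∂chainLaw Pbar l μ := by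
  rw [← lintegral_map (g := fun ω : ℕ → X × Θ => (Preorder.frestrictLe n ω, ω (n + 1))) hF
    (by fun_prop), map_chainLaw_compProd, Measure.lintegral_compProd hF,
    lintegral_map hF.lintegral_kernel_prod_right' (by fun_prop)]
  rfl

lemma integral_chainLaw_succ (l n : ℕ) (μ : Measure (X × Θ)) [IsProbabilityMeasure μ]
    {F : (Finset.Iic n → X × Θ) × (X × Θ) → ℝ} (hF : Measurable F) {K : ℝ}
    (hK : ∀ p, |F p| ≤ K) :
    ∫ ω, F (Preorder.frestrictLe n ω, ω (n + 1)) ∂chainLaw Pbar l μ =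
      ∫ ω, ∫ y, F (Preorder.frestrictLe n ω, y) ∂Pbar (l + n) (ω n) ∂chainLaw Pbar l μ := by
  have : IsProbabilityMeasure ((chainLaw Pbar l μ).map
      (Preorder.frestrictLe (π := fun _ => X × Θ) n)) :=
    Measure.isProbabilityMeasure_map (by fun_prop)
  rw [← integral_map (φ := fun ω : ℕ → X × Θ => (Preorder.frestrictLe n ω, ω (n + 1)))
    (by fun_prop) hF.aestronglyMeasurable, map_chainLaw_compProd,
    Measure.integral_compProd (Integrable.of_bound hF.aestronglyMeasurable K
      (ae_of_all _ fun p => by simpa using hK p)),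
    integral_map (by fun_prop)
      hF.stronglyMeasurable.integral_kernel_prod_right'.aestronglyMeasurable]
  rfl

variable {Pbar} {S : Set (X × Θ)} {h : X × Θ → ℝ≥0∞}

lemma taboo_one_le (l j : ℕ) (z : X × Θ) : taboo Pbar S (fun _ => 1) l j z ≤ 1 := by
  induction j generalizing l z with
  | zero => exact le_rfl
  | succ j ih =>
    refine (lintegral_mono (g := fun _ => 1) fun y => ?_).trans (by simp)
    exact (Set.indicator_le_self _ _ y).trans (ih _ y)

/-- The probability of remaining in `S` for `j` steps, weighted by a function of the past. -/
lemma lintegral_chainLaw_mul_prod (l : ℕ) (μ : Measure (X × Θ)) [IsProbabilityMeasure μ]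
    (hS : MeasurableSet S) (j n : ℕ) {F : (Finset.Iic n → X × Θ) → ℝ≥0∞} (hF : Measurable F) :
    ∫⁻ ω, F (Preorder.frestrictLe n ω) *
        ∏ i ∈ Finset.range j, S.indicator 1 (ω (n + 1 + i)) ∂chainLaw Pbar l μ =
      ∫⁻ ω, F (Preorder.frestrictLe n ω) * taboo Pbar S (fun _ => 1) (l + n) j (ω n)
        ∂chainLaw Pbar l μ := by
  induction j generalizing n with
  | zero => simp [taboo]
  | succ j ih =>
    have h1 : Measurable (S.indicator (1 : X × Θ → ℝ≥0∞)) := measurable_one.indicator hS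
    have hr : Measurable (Preorder.frestrictLe₂ (π := fun _ => X × Θ) n.le_succ) :=
      Preorder.measurable_frestrictLe₂ _
    have he : Measurable fun ω : Finset.Iic (n + 1) → X × Θ =>
        ω ⟨n + 1, Finset.mem_Iic.2 le_rfl⟩ := by fun_prop
    have hT := measurable_taboo (Pbar := Pbar) hS (measurable_const (a := (1 : ℝ≥0∞)))
      (l + n + 1) j
    -- The constraint at time `n + 1` joins the weight on the past; one Markov step then brings it
    -- back to time `n`.
    have := ih (n + 1)
      (F := fun w => F (Preorder.frestrictLe₂ (π := fun _ => X × Θ) n.le_succ w) *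
        S.indicator 1 (w ⟨n + 1, Finset.mem_Iic.2 le_rfl⟩))
      ((hF.comp hr).mul (h1.comp he))
    calc _ = ∫⁻ ω, F (Preorder.frestrictLe n ω) * S.indicator 1 (ω (n + 1)) *
          ∏ i ∈ Finset.range j, S.indicator 1 (ω (n + 1 + 1 + i)) ∂chainLaw Pbar l μ := by
          refine lintegral_congr fun ω => ?_
          rw [Finset.prod_range_succ', mul_assoc, mul_comm (∏ i ∈ _, _), add_zero]
          simp only [add_comm, add_left_comm]
      _ = _ := this
      _ = ∫⁻ ω, F (Preorder.frestrictLe n ω) * S.indicator 1 (ω (n + 1)) *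
          taboo Pbar S (fun _ => 1) (l + n + 1) j (ω (n + 1)) ∂chainLaw Pbar l μ := rfl
      _ = _ := by
          rw [lintegral_chainLaw_succ Pbar l n μ (F := fun p => F p.1 * S.indicator 1 p.2 *
            taboo Pbar S (fun _ => 1) (l + n + 1) j p.2)
            (((hF.comp measurable_fst).mul (h1.comp measurable_snd)).mul
              (hT.comp measurable_snd))]
          refine lintegral_congr fun ω => ?_
          simp only [taboo]
          rw [← lintegral_const_mul _ (hT.indicator hS)]
          refine lintegral_congr fun y => ?_
          by_cases hy : y ∈ S <;> simp [hy]

lemma lintegral_chainLaw_zero (l : ℕ) (μ : Measure (X × Θ)) [IsProbabilityMeasure μ]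
    (hh : Measurable h) : ∫⁻ ω, h (ω 0) ∂chainLaw Pbar l μ = ∫⁻ z, h z ∂μ := by
  conv_rhs => rw [← map_zero_chainLaw Pbar l μ]
  rw [lintegral_map hh (by fun_prop)]

/-- Links the recursive survival probability to trajectory space, where the return-time moment is
bounded. -/
lemma taboo_one_eq_lintegral (hS : MeasurableSet S) (l j : ℕ) (z : X × Θ) :
    taboo Pbar S (fun _ => 1) l j z =
      ∫⁻ ω, ∏ i ∈ Finset.range j, S.indicator 1 (ω (1 + i))
        ∂chainLaw Pbar l (Measure.dirac z) := by
  have hT := measurable_taboo (Pbar := Pbar) hS (measurable_const (a := (1 : ℝ≥0∞))) l j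
  have := lintegral_chainLaw_mul_prod (Pbar := Pbar) l (Measure.dirac z) hS j 0
    (F := fun _ => 1) measurable_const
  simp only [one_mul, zero_add, add_zero] at this
  rw [this, lintegral_chainLaw_zero l _ hT, lintegral_dirac' _ hT]

/-- Decomposition of `E[h(Z_n)]` according to the last time at which the chain is outside `S`. -/
lemma lintegral_taboo_le (μ : Measure (X × Θ)) [IsProbabilityMeasure μ] (hS : MeasurableSet S)
    (hh : Measurable h) {b : ℕ → ℝ≥0∞} (hb : ∀ l j, ∀ z ∉ S, taboo Pbar S h l j z ≤ b j)
    (k j : ℕ) :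
    ∫⁻ ω, taboo Pbar S h k j (ω k) ∂chainLaw Pbar 0 μ ≤
      (∑ i ∈ Finset.range k, b (j + i)) + ∫⁻ z, taboo Pbar S h 0 (j + k) z ∂μ := by
  induction k generalizing j with
  | zero => simp [lintegral_chainLaw_zero 0 μ (measurable_taboo (Pbar := Pbar) hS hh 0 j)]
  | succ k ih =>
    have hT := measurable_taboo (Pbar := Pbar) hS hh (k + 1) j
    have hstep : ∫⁻ ω, S.indicator (taboo Pbar S h (k + 1) j) (ω (k + 1)) ∂chainLaw Pbar 0 μ =
        ∫⁻ ω, taboo Pbar S h k (j + 1) (ω k) ∂chainLaw Pbar 0 μ := by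
      have := lintegral_chainLaw_succ Pbar 0 k μ
        (F := fun p => S.indicator (taboo Pbar S h (k + 1) j) p.2)
        ((hT.indicator hS).comp measurable_snd)
      simpa [taboo] using this
    -- Outside `S` at time `k + 1`, the last exit is found and costs `b j`; inside `S`, the search
    -- goes one step further back.
    calc ∫⁻ ω, taboo Pbar S h (k + 1) j (ω (k + 1)) ∂chainLaw Pbar 0 μ
        ≤ ∫⁻ ω, (b j + S.indicator (taboo Pbar S h (k + 1) j) (ω (k + 1)))
            ∂chainLaw Pbar 0 μ := by
          refine lintegral_mono fun ω => ?_
          by_cases hω : ω (k + 1) ∈ S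
          · simp [hω]
          · simpa [hω] using hb (k + 1) j _ hω
      _ = b j + ∫⁻ ω, taboo Pbar S h k (j + 1) (ω k) ∂chainLaw Pbar 0 μ := by
          rw [lintegral_add_left measurable_const, hstep]; simp
      _ ≤ _ := by
          rw [Finset.sum_range_succ', add_zero, add_comm (∑ i ∈ _, _), add_assoc]
          refine add_le_add le_rfl ((ih (j + 1)).trans_eq ?_)
          simp only [add_comm, add_left_comm]

end Chain


/-! ### Boundedness in probability of the drift function. -/

section Tightness

variable {X Θ : Type*} [MeasurableSpace X] [MeasurableSpace Θ]
  {Pbar : ℕ → Kernel (X × Θ) (X × Θ)} {S : Set (X × Θ)} {W : X × Θ → ℝ≥0∞} {B R : ℝ≥0∞}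

/-- `W` along the chain killed on leaving `S` is a supermartingale; a start outside `S` pays `B` for
its first step. The term `W z` in `hB` covers `j = 0`. -/
lemma taboo_le_of_drift (hd : ∀ l, ∀ z ∈ S, ∫⁻ y, W y ∂Pbar l z ≤ W z)
    (hB : ∀ l, ∀ z ∉ S, ∫⁻ y, W y ∂Pbar l z + W z ≤ B) (l j : ℕ) (z : X × Θ) :
    (z ∈ S → taboo Pbar S W l j z ≤ W z) ∧ (z ∉ S → taboo Pbar S W l j z ≤ B) := by
  induction j generalizing l z with
  | zero => exact ⟨fun _ => le_rfl, fun hz => le_add_self.trans (hB l z hz)⟩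
  | succ j ih =>
    have hle : taboo Pbar S W l (j + 1) z ≤ ∫⁻ y, W y ∂Pbar l z := by
      refine lintegral_mono fun y => ?_
      by_cases hy : y ∈ S
      · simpa [hy] using (ih (l + 1) y).1 hy
      · simp [hy]
    exact ⟨fun hz => hle.trans (hd l z hz),
      fun hz => hle.trans (le_self_add.trans (hB l z hz))⟩

lemma tendsto_const_div_natCast_add_one {a : ℝ≥0∞} (ha : a ≠ ∞) :
    Tendsto (fun M : ℕ => a / (M + 1 : ℕ)) atTop (𝓝 0) := by
  have h : Tendsto (fun M : ℕ => a / (M : ℝ≥0∞)) atTop (𝓝 0) := by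
    simpa [div_eq_mul_inv] using
      ENNReal.Tendsto.const_mul ENNReal.tendsto_inv_nat_nhds_zero (Or.inr ha)
  exact h.comp (tendsto_add_atTop_nat 1)

/-- Drift outside of `Sᶜ`, together with summable uniform tails of the return time to `Sᶜ`,
implies that `W (Z_n)` is bounded in probability. -/
lemma exists_measure_lt_le [∀ n, IsMarkovKernel (Pbar n)] (μ : Measure (X × Θ))
    [IsProbabilityMeasure μ] (hS : MeasurableSet S) (hW : Measurable W) (hWtop : ∀ z, W z ≠ ∞)
    (hd : ∀ l, ∀ z ∈ S, ∫⁻ y, W y ∂Pbar l z ≤ W z)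
    (hB : ∀ l, ∀ z ∉ S, ∫⁻ y, W y ∂Pbar l z + W z ≤ B) (hBtop : B ≠ ∞)
    {b : ℕ → ℝ≥0∞} (hb : ∀ l j, ∀ z ∉ S, taboo Pbar S (fun _ => 1) l j z ≤ b j)
    (hbsum : ∑' j, b j ≠ ∞) {ε : ℝ≥0∞} (hε : 0 < ε) :
    ∃ M : ℕ, ∀ n, chainLaw Pbar 0 μ {ω | ((M + 1 : ℕ) : ℝ≥0∞) < W (ω n)} ≤ ε := by
  have h1 : Tendsto (fun M : ℕ => ∑' j, min (B / (M + 1 : ℕ)) (b j)) atTop (𝓝 0) := by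
    have := tendsto_lintegral_of_dominated_convergence (μ := Measure.count)
      (F := fun (M : ℕ) (j : ℕ) => min (B / (M + 1 : ℕ)) (b j)) (f := fun _ => 0) b
      (fun _ => Measurable.of_discrete) (fun _ => ae_of_all _ fun _ => min_le_right _ _)
      (by rwa [lintegral_count])
      (ae_of_all _ fun j => tendsto_of_tendsto_of_tendsto_of_le_of_le tendsto_const_nhds
        (tendsto_const_div_natCast_add_one hBtop) (fun _ => zero_le) fun _ => min_le_left _ _)
    simpa [lintegral_count] using this
  -- Paths with no exit after time `0`. The truncation at `1` allows `W` to be non-integrable under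
  -- `μ`.
  have h2 : Tendsto (fun M : ℕ => ∫⁻ z, min ((W z + B) / (M + 1 : ℕ)) 1 ∂μ) atTop (𝓝 0) := by
    have := tendsto_lintegral_of_dominated_convergence (μ := μ)
      (F := fun (M : ℕ) z => min ((W z + B) / (M + 1 : ℕ)) 1) (f := fun _ => 0) (fun _ => 1)
      (fun _ => ((hW.add_const _).div_const _).min measurable_const)
      (fun _ => ae_of_all _ fun _ => min_le_right _ _) (by simp)
      (ae_of_all _ fun z => tendsto_of_tendsto_of_tendsto_of_le_of_le tendsto_const_nhds
        (tendsto_const_div_natCast_add_one (ENNReal.add_ne_top.2 ⟨hWtop z, hBtop⟩))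
        (fun _ => zero_le) fun _ => min_le_left _ _)
    simpa using this
  have h3 := h1.add h2
  rw [add_zero] at h3
  obtain ⟨M, hM⟩ := (h3.eventually_le_const hε).exists
  refine ⟨M, fun n => le_trans ?_ hM⟩
  set m : ℝ≥0∞ := ((M + 1 : ℕ) : ℝ≥0∞) with hm
  have hm0 : m ≠ 0 := by simp [hm]
  have hmtop : m ≠ ∞ := by simp [hm]
  have hA : MeasurableSet {z | m < W z} := measurableSet_lt measurable_const hW
  have hh : Measurable ({z | m < W z}.indicator (1 : X × Θ → ℝ≥0∞)) := measurable_one.indicator hA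
  have hle1 : {z | m < W z}.indicator (1 : X × Θ → ℝ≥0∞) ≤ fun _ => 1 :=
    Set.indicator_le_self _ _
  have hleW : {z | m < W z}.indicator (1 : X × Θ → ℝ≥0∞) ≤ fun z => m⁻¹ * W z := by
    intro z
    by_cases hz : m < W z
    · simp only [Set.indicator_apply, Set.mem_ofPred_eq, hz, if_true, Pi.one_apply]
      rw [← ENNReal.inv_mul_cancel hm0 hmtop]
      gcongr
    · simp [hz]
  have ht1 := fun l j => taboo_mono (Pbar := Pbar) (S := S) hle1 l j
  have htW : ∀ l j z, taboo Pbar S ({z | m < W z}.indicator 1) l j z ≤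
      taboo Pbar S W l j z / m := fun l j z => by
    refine (taboo_mono (Pbar := Pbar) (S := S) hleW l j z).trans_eq ?_
    rw [taboo_const_mul hS hW, mul_comm, div_eq_mul_inv]
  have hmain := lintegral_taboo_le (Pbar := Pbar) μ hS hh (b := fun j => min (B / m) (b j))
    (fun l j z hz => le_min ((htW l j z).trans
      (ENNReal.div_le_div_right ((taboo_le_of_drift hd hB l j z).2 hz) _))
      ((ht1 l j z).trans (hb l j z hz))) n 0
  have hlhs : ∫⁻ ω, taboo Pbar S ({z | m < W z}.indicator 1) n 0 (ω n) ∂chainLaw Pbar 0 μ =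
      chainLaw Pbar 0 μ {ω | m < W (ω n)} := by
    rw [← lintegral_indicator_one (show MeasurableSet {ω : ℕ → X × Θ | m < W (ω n)} from
      measurable_pi_apply (X := fun _ : ℕ => X × Θ) n hA)]
    rfl
  rw [← hlhs]
  refine hmain.trans (add_le_add ?_ (lintegral_mono fun z => le_min ?_ ?_))
  · simpa using ENNReal.sum_le_tsum (f := fun j => min (B / m) (b j)) (Finset.range n)
  · refine (htW 0 (0 + n) z).trans (ENNReal.div_le_div_right ?_ _)
    by_cases hz : z ∈ S
    · exact ((taboo_le_of_drift hd hB 0 _ z).1 hz).trans le_self_add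
    · exact ((taboo_le_of_drift hd hB 0 _ z).2 hz).trans le_add_self
  · exact (ht1 0 (0 + n) z).trans (taboo_one_le _ _ z)

end Tightness

/-! ### Distance between kernels and diminishing adaptation. -/

section KernelDist

variable {X Θ : Type*} [MeasurableSpace X] (P : Θ → Kernel X X)

lemma ofReal_abs_integral_sub_le_tvNorm (μ ν : Measure X) {f : X → ℝ} (hf : Measurable f)
    (hf1 : ∀ x, |f x| ≤ 1) :
    ENNReal.ofReal |∫ x, f x ∂μ - ∫ x, f x ∂ν| ≤ tvNorm μ ν :=
  le_iSup_of_le f (le_iSup₂_of_le hf hf1 le_rfl)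

lemma tvNorm_triangle (μ ν ρ : Measure X) : tvNorm μ ρ ≤ tvNorm μ ν + tvNorm ν ρ := by
  refine iSup_le fun f => iSup₂_le fun hf hf1 => ?_
  refine le_trans ?_ (add_le_add (ofReal_abs_integral_sub_le_tvNorm μ ν hf hf1)
    (ofReal_abs_integral_sub_le_tvNorm ν ρ hf hf1))
  rw [← ENNReal.ofReal_add (abs_nonneg _) (abs_nonneg _)]
  exact ENNReal.ofReal_le_ofReal (abs_sub_le _ _ _)

lemma kernelDist_self (θ : Θ) : kernelDist P θ θ = 0 := by
  simp [kernelDist, tvNorm]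

lemma kernelDist_triangle (a b c : Θ) :
    kernelDist P a c ≤ kernelDist P a b + kernelDist P b c :=
  iSup_le fun x => (tvNorm_triangle _ (P b x) _).trans
    (add_le_add (le_iSup (fun x => tvNorm (P a x) (P b x)) x)
      (le_iSup (fun x => tvNorm (P b x) (P c x)) x))

/-- Over a window of fixed length, the one-step changes add up by the triangle inequality. -/
lemma tendsto_measure_le_kernelDist [MeasurableSpace Θ]
    (ρ : Measure (ℕ → X × Θ))
    (hB : ∀ ε : ℝ, 0 < ε → Tendsto
      (fun n : ℕ => ρ {ω | ENNReal.ofReal ε ≤ kernelDist P (ω (n + 1)).2 (ω n).2}) atTop (𝓝 0))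
    (i : ℕ) (ε : ℝ) (hε : 0 < ε) :
    Tendsto (fun n : ℕ => ρ {ω | ENNReal.ofReal ε ≤ kernelDist P (ω (n + i)).2 (ω n).2})
      atTop (𝓝 0) := by
  induction i generalizing ε with
  | zero => simp [kernelDist_self, hε.not_ge]
  | succ i ih =>
    have h := ((hB (ε / 2) (half_pos hε)).comp (tendsto_add_atTop_nat i)).add
      (ih (ε / 2) (half_pos hε))
    rw [add_zero] at h
    refine tendsto_of_tendsto_of_tendsto_of_le_of_le tendsto_const_nhds h (fun _ => zero_le)
      fun n => (measure_mono fun ω hω => ?_).trans (measure_union_le _ _)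
    by_contra hcon
    simp only [Set.mem_union, Set.mem_ofPred_eq, not_or, not_le] at hcon hω
    refine (hω.trans (kernelDist_triangle P _ (ω (n + i)).2 _)).not_gt ?_
    have := ENNReal.add_lt_add hcon.1 hcon.2
    rwa [← ENNReal.ofReal_add (half_pos hε).le (half_pos hε).le, add_halves] at this

end KernelDist

/-- An integral is small if the integrand is bounded by `2` and small outside a small set. -/
lemma abs_integral_le_add_two_mul {Ω : Type*} [MeasurableSpace Ω] (ρ : Measure Ω)
    [IsProbabilityMeasure ρ] {g : Ω → ℝ} (hg : Measurable g) (hg2 : ∀ ω, |g ω| ≤ 2) {δ : ℝ}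
    (hδ : 0 ≤ δ) {A : Set Ω} (hA : ∀ ω ∉ A, |g ω| ≤ δ) :
    |∫ ω, g ω ∂ρ| ≤ δ + 2 * (ρ A).toReal := by
  -- `A` may be non-measurable, so the integral is split along this measurable subset of it.
  have hT : MeasurableSet {ω | δ < |g ω|} := measurableSet_lt measurable_const hg.abs
  have hTA : {ω | δ < |g ω|} ⊆ A := fun ω hω => by
    by_contra h
    exact absurd (hA ω h) (not_le.2 hω)
  have hi : Integrable ({ω | δ < |g ω|}.indicator fun _ => (2 : ℝ)) ρ :=
    (integrable_const _).indicator hT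
  calc |∫ ω, g ω ∂ρ| ≤ ∫ ω, |g ω| ∂ρ := abs_integral_le_integral_abs
    _ ≤ ∫ ω, (δ + {ω | δ < |g ω|}.indicator (fun _ => (2 : ℝ)) ω) ∂ρ := by
        refine integral_mono (Integrable.of_bound hg.abs.aestronglyMeasurable 2
          (ae_of_all _ fun ω => by simpa using hg2 ω)) ((integrable_const _).add hi) fun ω => ?_
        by_cases hω : δ < |g ω|
        · simp only [Set.indicator_apply, Set.mem_ofPred_eq, hω, if_true]
          linarith [hg2 ω]
        · simpa [hω] using not_lt.1 hω
    _ = δ + 2 * (ρ {ω | δ < |g ω|}).toReal := by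
        rw [integral_add (integrable_const _) hi, integral_indicator_const _ hT]
        simp [Measure.real, mul_comm]
    _ ≤ _ := by
        gcongr
        exact measure_ne_top _ _

lemma map_fst_eq {X Θ : Type*} [MeasurableSpace X] [MeasurableSpace Θ]
    {P : Θ → Kernel X X} {Pbar : ℕ → Kernel (X × Θ) (X × Θ)}
    (hPbar : ∀ (n : ℕ) (x : X) (θ : Θ) (A : Set X), MeasurableSet A →
    Pbar n (x, θ) (A ×ˢ Set.univ) = P θ x A) (n : ℕ) (z : X × Θ) :
    (Pbar n z).map Prod.fst = P z.2 z.1 := by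
  ext A hA
  rw [Measure.map_apply measurable_fst hA, ← hPbar n z.1 z.2 A hA, Set.prod_univ]

/-! ### Iterates of the frozen kernels. -/

section Semigroup

variable {X Θ : Type*} [MeasurableSpace X] [MeasurableSpace Θ]
  {P : Θ → Kernel X X} [∀ θ, IsMarkovKernel (P θ)]
  {Pbar : ℕ → Kernel (X × Θ) (X × Θ)} [∀ n, IsMarkovKernel (Pbar n)]

lemma isMarkovKernel_pow (κ : Kernel X X) [IsMarkovKernel κ] (j : ℕ) :
    IsMarkovKernel (κ ^ j) := by
  induction j with
  | zero => exact inferInstanceAs (IsMarkovKernel Kernel.id)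
  | succ j ih => exact inferInstanceAs (IsMarkovKernel ((κ ^ j) ∘ₖ κ))

lemma abs_integral_le_one {μ : Measure X} [IsProbabilityMeasure μ] {f : X → ℝ}
    (hf1 : ∀ x, |f x| ≤ 1) : |∫ x, f x ∂μ| ≤ 1 := by
  simpa using norm_integral_le_of_norm_le_const (μ := μ) (f := f) (C := 1) (ae_of_all _ fun x => by simpa using hf1 x)

lemma integral_pow_succ (κ : Kernel X X) [IsMarkovKernel κ] {f : X → ℝ} (hf : Measurable f)
    (hf1 : ∀ x, |f x| ≤ 1) (j : ℕ) (x : X) :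
    ∫ y, f y ∂(κ ^ (j + 1)) x = ∫ y, ∫ z, f z ∂(κ ^ j) y ∂κ x := by
  have := isMarkovKernel_pow κ j
  have := isMarkovKernel_pow κ (j + 1)
  have hi : Integrable f ((κ ^ (j + 1)) x) :=
    Integrable.of_bound hf.aestronglyMeasurable 1 (ae_of_all _ fun x => by simpa using hf1 x)
  exact Kernel.integral_comp hi

/-- Joint measurability in `(x, θ)` is inherited from `Pbar 0`, whose first marginal at `(x, θ)` is
`P θ x`. -/
lemma measurable_integral_pow (hPbar : ∀ (n : ℕ) (x : X) (θ : Θ) (A : Set X), MeasurableSet A →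
    Pbar n (x, θ) (A ×ˢ Set.univ) = P θ x A) {f : X → ℝ} (hf : Measurable f)
    (hf1 : ∀ x, |f x| ≤ 1) (j : ℕ) :
    Measurable fun z : X × Θ => ∫ y, f y ∂(P z.2 ^ j) z.1 := by
  induction j with
  | zero =>
    have : (fun z : X × Θ => ∫ y, f y ∂(P z.2 ^ 0) z.1) = fun z => f z.1 := by
      ext z
      rw [pow_zero]
      exact (congrArg (fun m => ∫ y, f y ∂m) (Kernel.id_apply z.1)).trans
        (integral_dirac' f z.1 hf.stronglyMeasurable)
    rw [this]
    exact hf.comp measurable_fst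
  | succ j ih =>
    have heq : (fun z : X × Θ => ∫ y, f y ∂(P z.2 ^ (j + 1)) z.1) =
        fun z => ∫ y, (∫ w, f w ∂(P z.2 ^ j) y.1) ∂Pbar 0 z := by
      ext z
      rw [integral_pow_succ _ hf hf1, ← map_fst_eq hPbar 0 z, integral_map (by fun_prop)]
      exact (ih.comp (measurable_id.prodMk measurable_const)).aestronglyMeasurable
    rw [heq]
    have h : Measurable fun p : (X × Θ) × (X × Θ) => ∫ w, f w ∂(P p.1.2 ^ j) p.2.1 :=
      ih.comp ((measurable_fst.comp measurable_snd).prodMk (measurable_snd.comp measurable_fst))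
    exact (h.stronglyMeasurable.integral_kernel_prod_right' (κ := Pbar 0)).measurable

end Semigroup


/-! ### Comparison with the frozen chain and convergence. -/

section Convergence

variable {X Θ : Type*} [MeasurableSpace X] [MeasurableSpace Θ]
  {P : Θ → Kernel X X} [∀ θ, IsMarkovKernel (P θ)]
  {Pbar : ℕ → Kernel (X × Θ) (X × Θ)} [∀ n, IsMarkovKernel (Pbar n)]

/-- The error made by replacing the transition of the adaptive chain from time `n + i` to time
`n + i + 1` by a transition with the parameter frozen at time `n`. -/
lemma abs_integral_pow_sub_le (hPbar : ∀ (n : ℕ) (x : X) (θ : Θ) (A : Set X), MeasurableSet A →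
      Pbar n (x, θ) (A ×ˢ Set.univ) = P θ x A)
    (μ : Measure (X × Θ)) [IsProbabilityMeasure μ] {f : X → ℝ} (hf : Measurable f)
    (hf1 : ∀ x, |f x| ≤ 1) (n i j : ℕ) {δ : ℝ} (hδ : 0 < δ) :
    |∫ ω, (∫ y, f y ∂(P (ω n).2 ^ j) (ω (n + i + 1)).1) ∂chainLaw Pbar 0 μ -
        ∫ ω, (∫ y, f y ∂(P (ω n).2 ^ (j + 1)) (ω (n + i)).1) ∂chainLaw Pbar 0 μ| ≤
      δ + 2 * (chainLaw Pbar 0 μ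
        {ω | ENNReal.ofReal δ ≤ kernelDist P (ω (n + i)).2 (ω n).2}).toReal := by
  have hpow : ∀ θ k, IsMarkovKernel (P θ ^ k) := fun θ k => isMarkovKernel_pow (P θ) k
  have hmeas := fun k => measurable_integral_pow hPbar hf hf1 k
  have hb : ∀ k (z : X × Θ), |∫ y, f y ∂(P z.2 ^ k) z.1| ≤ 1 := fun k z =>
    abs_integral_le_one hf1
  have hin : n ∈ Finset.Iic (n + i) := Finset.mem_Iic.2 (Nat.le_add_right n i)

  have hmG : Measurable fun p : (X × Θ) × (X × Θ) =>
      ∫ y, (∫ w, f w ∂(P p.2.2 ^ j) y.1) ∂Pbar (0 + (n + i)) p.1 := by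
    have h : Measurable fun q : ((X × Θ) × (X × Θ)) × (X × Θ) =>
        ∫ w, f w ∂(P q.1.2.2 ^ j) q.2.1 :=
      (hmeas j).comp ((measurable_fst.comp measurable_snd).prodMk
        (measurable_snd.comp (measurable_snd.comp measurable_fst)))
    exact (h.stronglyMeasurable.integral_kernel_prod_right'
      (κ := (Pbar (0 + (n + i))).comap Prod.fst measurable_fst)).measurable
  -- With the parameter frozen at `z'.2`, the integrand sees only the first coordinate of the next
  -- state.
  have hG : ∀ z z' : X × Θ, ∫ y, (∫ w, f w ∂(P z'.2 ^ j) y.1) ∂Pbar (0 + (n + i)) z =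
      ∫ y, (∫ w, f w ∂(P z'.2 ^ j) y) ∂P z.2 z.1 := by
    intro z z'
    rw [← map_fst_eq hPbar (0 + (n + i)) z, integral_map (by fun_prop)]
    exact ((hmeas j).comp (measurable_id.prodMk measurable_const)).aestronglyMeasurable
  have hstep : ∫ ω, (∫ y, f y ∂(P (ω n).2 ^ j) (ω (n + i + 1)).1) ∂chainLaw Pbar 0 μ =
      ∫ ω, (∫ y, (∫ w, f w ∂(P (ω n).2 ^ j) y) ∂P (ω (n + i)).2 (ω (n + i)).1)
        ∂chainLaw Pbar 0 μ := by
    have := integral_chainLaw_succ Pbar 0 (n + i) μ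
      (F := fun p => ∫ y, f y ∂(P (p.1 ⟨n, hin⟩).2 ^ j) p.2.1)
      ((hmeas j).comp ((measurable_fst.comp measurable_snd).prodMk
        (measurable_snd.comp ((measurable_pi_apply _).comp measurable_fst)))) (K := 1)
      (fun p => hb j (p.2.1, (p.1 ⟨n, hin⟩).2))
    refine this.trans (integral_congr_ae (ae_of_all _ fun ω => ?_))
    exact hG (ω (n + i)) (ω n)
  have hm1 : Measurable fun ω : ℕ → X × Θ =>
      ∫ y, (∫ w, f w ∂(P (ω n).2 ^ j) y) ∂P (ω (n + i)).2 (ω (n + i)).1 := by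
    simp only [← hG]
    exact hmG.comp (g := fun p : (X × Θ) × (X × Θ) =>
      ∫ y, (∫ w, f w ∂(P p.2.2 ^ j) y.1) ∂Pbar (0 + (n + i)) p.1)
      (f := fun ω : ℕ → X × Θ => (ω (n + i), ω n))
      ((measurable_pi_apply (n + i)).prodMk (measurable_pi_apply n))
  have hmk : ∀ k, Measurable fun ω : ℕ → X × Θ =>
      ∫ y, f y ∂(P (ω n).2 ^ k) (ω (n + i)).1 := fun k => by
    have hp : Measurable fun ω : ℕ → X × Θ => ((ω (n + i)).1, (ω n).2) := by fun_prop
    exact (hmeas k).comp hp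
  have hm2 := hmk (j + 1)
  have hb1 : ∀ ω : ℕ → X × Θ,
      |∫ y, (∫ w, f w ∂(P (ω n).2 ^ j) y) ∂P (ω (n + i)).2 (ω (n + i)).1| ≤ 1 := fun ω =>
    abs_integral_le_one fun y => hb j (y, (ω n).2)
  have hb2 : ∀ ω : ℕ → X × Θ, |∫ y, f y ∂(P (ω n).2 ^ (j + 1)) (ω (n + i)).1| ≤ 1 := fun ω =>
    abs_integral_le_one hf1
  rw [hstep, ← integral_sub
    (Integrable.of_bound hm1.aestronglyMeasurable 1 (ae_of_all _ fun ω => by simpa using hb1 ω))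
    (Integrable.of_bound hm2.aestronglyMeasurable 1 (ae_of_all _ fun ω => by simpa using hb2 ω))]
  refine abs_integral_le_add_two_mul _ (hm1.sub hm2)
    (fun ω => (abs_sub _ _).trans (by linarith [hb1 ω, hb2 ω])) hδ.le fun ω hω => ?_
  rw [Pi.sub_apply, integral_pow_succ _ hf hf1]
  have hlt : kernelDist P (ω (n + i)).2 (ω n).2 < ENNReal.ofReal δ := by simpa using hω
  -- `P_{θ_n}^j f` is itself a test function bounded by `1`, so the two first steps differ by at
  -- most `D(θ_{n+i}, θ_n)`.
  have h := (ofReal_abs_integral_sub_le_tvNorm (P (ω (n + i)).2 (ω (n + i)).1)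
    (P (ω n).2 (ω (n + i)).1) (f := fun y => ∫ w, f w ∂(P (ω n).2 ^ j) y)
    ((hmeas j).comp (measurable_id.prodMk measurable_const))
    (fun y => hb j (y, (ω n).2))).trans
    (le_iSup (fun x => tvNorm (P (ω (n + i)).2 x) (P (ω n).2 x)) (ω (n + i)).1)
  exact (ENNReal.ofReal_le_ofReal_iff hδ.le).1 (h.trans hlt.le)

/-- Under diminishing adaptation, the adaptive chain is asymptotically indistinguishable over a
window of fixed length from the chain with parameter frozen at the start of the window. -/
lemma eventually_abs_integral_pow_sub_le
    (hPbar : ∀ (n : ℕ) (x : X) (θ : Θ) (A : Set X), MeasurableSet A →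
      Pbar n (x, θ) (A ×ˢ Set.univ) = P θ x A)
    (μ : Measure (X × Θ)) [IsProbabilityMeasure μ]
    (hB : ∀ ε : ℝ, 0 < ε → Tendsto (fun n : ℕ => chainLaw Pbar 0 μ
      {ω | ENNReal.ofReal ε ≤ kernelDist P (ω (n + 1)).2 (ω n).2}) atTop (𝓝 0))
    (N : ℕ) {ε : ℝ} (hε : 0 < ε) :
    ∀ᶠ n in atTop, ∀ f : X → ℝ, Measurable f → (∀ x, |f x| ≤ 1) → ∀ j,
      |∫ ω, (∫ y, f y ∂(P (ω n).2 ^ j) (ω (n + N)).1) ∂chainLaw Pbar 0 μ -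
        ∫ ω, (∫ y, f y ∂(P (ω n).2 ^ (j + N)) (ω n).1) ∂chainLaw Pbar 0 μ| ≤ ε := by
  induction N generalizing ε with
  | zero => simp [hε.le]
  | succ N ih =>
    have h1 : Tendsto (fun n => (chainLaw Pbar 0 μ
        {ω | ENNReal.ofReal (ε / 4) ≤ kernelDist P (ω (n + N)).2 (ω n).2}).toReal)
        atTop (𝓝 0) := by
      have := (ENNReal.tendsto_toReal ENNReal.zero_ne_top).comp
        (tendsto_measure_le_kernelDist P _ hB N (ε / 4) (by positivity))
      rwa [ENNReal.toReal_zero] at this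
    filter_upwards [ih (half_pos hε), h1.eventually_le_const (show 0 < ε / 8 by positivity)]
      with n hn hn1 f hf hf1 j
    -- The last transition is frozen at cost `ε / 4 + 2 * (ε / 8) = ε / 2`. This raises the exponent
    -- to `j + 1`, hence the induction is uniform in `j`.
    have h2 := abs_integral_pow_sub_le hPbar μ hf hf1 n N j (δ := ε / 4) (by positivity)
    have h3 := hn f hf hf1 (j + 1)
    rw [show j + 1 + N = j + (N + 1) by ring] at h3
    rw [← add_assoc n N 1]
    exact (abs_sub_le _ _ _).trans (by linarith)

/-- Convergence in total variation of the marginals under ergodicity of the frozen kernels,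
uniform on the sublevel sets of a function that is bounded in probability along the chain. -/
theorem tendsto_iSup_abs_integral
    (hPbar : ∀ (n : ℕ) (x : X) (θ : Θ) (A : Set X), MeasurableSet A →
      Pbar n (x, θ) (A ×ˢ Set.univ) = P θ x A)
    {V : X → ℝ} (hV1 : ∀ x, 1 ≤ V x) (π : Measure X) [IsProbabilityMeasure π]
    (herg : Tendsto (fun n : ℕ => ⨆ x : X, ENNReal.ofReal (V x)⁻¹ *
      ⨆ θ : Θ, tvNorm ((P θ ^ n) x) π) atTop (𝓝 0))
    (μ : Measure (X × Θ)) [IsProbabilityMeasure μ]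
    (htight : ∀ ε : ℝ≥0∞, 0 < ε →
      ∃ M : ℕ, ∀ n, chainLaw Pbar 0 μ {ω | (M + 1 : ℝ) < V (ω n).1} ≤ ε)
    (hB : ∀ ε : ℝ, 0 < ε → Tendsto (fun n : ℕ => chainLaw Pbar 0 μ
      {ω | ENNReal.ofReal ε ≤ kernelDist P (ω (n + 1)).2 (ω n).2}) atTop (𝓝 0)) :
    Tendsto (fun n : ℕ => ⨆ (f : X → ℝ) (_ : Measurable f) (_ : ∀ x, |f x| ≤ 1),
      ENNReal.ofReal |∫ ω, (f (ω n).1 - ∫ y, f y ∂π) ∂chainLaw Pbar 0 μ|)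
      atTop (𝓝 0) := by
  rw [ENNReal.tendsto_nhds_zero]
  intro ε' hε'
  obtain ⟨ε, hε, hεε'⟩ : ∃ ε : ℝ, 0 < ε ∧ ENNReal.ofReal ε ≤ ε' := by
    obtain ⟨q, hq, hq'⟩ := ENNReal.lt_iff_exists_nnreal_btwn.1 hε'
    exact ⟨q, by exact_mod_cast hq, by simpa using hq'.le⟩
  -- Error budget: `ε / 2` for freezing, `ε / 4` for ergodicity where `V ≤ M + 1`, and `2 * (ε / 8)`
  -- elsewhere. `M` is fixed before the window length `N`.
  obtain ⟨M, hM⟩ := htight (ENNReal.ofReal (ε / 8)) (by simpa using hε)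
  have hMpos : (0 : ℝ) < M + 1 := by positivity
  obtain ⟨N, hN⟩ := (herg.eventually_le_const
    (show 0 < ENNReal.ofReal (ε / 4 / (M + 1)) by rw [ENNReal.ofReal_pos]; positivity)).exists
  have htv : ∀ x θ, V x ≤ M + 1 → tvNorm ((P θ ^ N) x) π ≤ ENNReal.ofReal (ε / 4) := by
    intro x θ hx
    have hVx : 0 < V x := zero_lt_one.trans_le (hV1 x)
    have h := (le_iSup (fun x => ENNReal.ofReal (V x)⁻¹ * ⨆ θ : Θ, tvNorm ((P θ ^ N) x) π)
      x).trans hN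
    calc tvNorm ((P θ ^ N) x) π ≤ ⨆ θ : Θ, tvNorm ((P θ ^ N) x) π :=
          le_iSup (fun θ => tvNorm ((P θ ^ N) x) π) θ
      _ = ENNReal.ofReal (V x) *
          (ENNReal.ofReal (V x)⁻¹ * ⨆ θ : Θ, tvNorm ((P θ ^ N) x) π) := by
          rw [← mul_assoc, ← ENNReal.ofReal_mul hVx.le, mul_inv_cancel₀ hVx.ne']
          simp
      _ ≤ ENNReal.ofReal (M + 1) * ENNReal.ofReal (ε / 4 / (M + 1)) := by gcongr
      _ = ENNReal.ofReal (ε / 4) := by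
          rw [← ENNReal.ofReal_mul hMpos.le]
          congr 1
          field_simp
  obtain ⟨n₀, hn₀⟩ := eventually_atTop.1
    (eventually_abs_integral_pow_sub_le hPbar μ hB N (half_pos hε))
  refine eventually_atTop.2 ⟨n₀ + N, fun k hk => ?_⟩
  obtain ⟨n, rfl⟩ : ∃ n, k = n + N := ⟨k - N, by omega⟩
  -- `M`, `N` and `n₀` do not depend on `f`, which yields total variation.
  refine iSup_le fun f => iSup₂_le fun hf hf1 =>
    (ENNReal.ofReal_le_ofReal ?_).trans hεε'
  have h1 := hn₀ n (by omega) f hf hf1 0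
  have hpow : ∀ θ, IsMarkovKernel (P θ ^ N) := fun θ => isMarkovKernel_pow (P θ) N
  have hid : ∀ θ x, ∫ y, f y ∂(P θ ^ 0) x = f x := by
    intro θ x
    rw [pow_zero]
    exact (congrArg (fun m => ∫ y, f y ∂m) (Kernel.id_apply x)).trans
      (integral_dirac' f x hf.stronglyMeasurable)
  simp only [hid, zero_add] at h1
  have hmN : Measurable fun ω : ℕ → X × Θ => ∫ y, f y ∂(P (ω n).2 ^ N) (ω n).1 :=
    (measurable_integral_pow hPbar hf hf1 N).comp (measurable_pi_apply n)
  have hbN : ∀ ω : ℕ → X × Θ, |∫ y, f y ∂(P (ω n).2 ^ N) (ω n).1| ≤ 1 := fun ω =>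
    abs_integral_le_one hf1
  have hπ : |∫ y, f y ∂π| ≤ 1 := abs_integral_le_one hf1
  have hiN : Integrable (fun ω : ℕ → X × Θ => ∫ y, f y ∂(P (ω n).2 ^ N) (ω n).1)
      (chainLaw Pbar 0 μ) :=
    Integrable.of_bound hmN.aestronglyMeasurable 1 (ae_of_all _ fun ω => by simpa using hbN ω)
  have hif : Integrable (fun ω : ℕ → X × Θ => f (ω (n + N)).1) (chainLaw Pbar 0 μ) :=
    Integrable.of_bound (hf.comp (measurable_fst.comp
      (measurable_pi_apply (n + N)))).aestronglyMeasurable 1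
      (ae_of_all _ fun ω => by simpa using hf1 _)
  have h2 := abs_integral_le_add_two_mul (chainLaw Pbar 0 μ) (hmN.sub_const (∫ y, f y ∂π))
    (fun ω => (abs_sub _ _).trans (by linarith [hbN ω, hπ]))
    (δ := ε / 4) (by positivity) (A := {ω | (M + 1 : ℝ) < V (ω n).1}) fun ω hω =>
      (ENNReal.ofReal_le_ofReal_iff (by positivity)).1
        ((ofReal_abs_integral_sub_le_tvNorm _ _ hf hf1).trans
          (htv (ω n).1 (ω n).2 (by simpa using hω)))
  have h3 : (chainLaw Pbar 0 μ {ω | (M + 1 : ℝ) < V (ω n).1}).toReal ≤ ε / 8 :=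
    ENNReal.toReal_le_of_le_ofReal (by positivity) (hM n)
  rw [integral_sub hiN (integrable_const _)] at h2
  rw [integral_sub hif (integrable_const _)]
  calc _ ≤ _ + _ := abs_sub_le _
        (∫ ω, (∫ y, f y ∂(P (ω n).2 ^ N) (ω n).1) ∂chainLaw Pbar 0 μ) _
    _ ≤ ε := by linarith

end Convergence

end AdaptiveMCMC

end

/-! ### The theorem: tightness from the drift and return-time conditions. -/

open AdaptiveMCMC in
theorem theorem2p1 {X Θ : Type*}
    [MeasurableSpace X] [MeasurableSpace.CountablyGenerated X]
    [MeasurableSpace Θ] [MeasurableSpace.CountablyGenerated Θ]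
    -- the Markov kernels `P_θ` on `X`, depending measurably on `θ`
    (P : Θ → Kernel X X) [∀ θ, IsMarkovKernel (P θ)]
    (_hP : ∀ (x : X) (A : Set X), MeasurableSet A → Measurable fun θ => P θ x A)
    -- the transition kernels of the adaptive chain on `X × Θ`
    (Pbar : ℕ → Kernel (X × Θ) (X × Θ)) [∀ n, IsMarkovKernel (Pbar n)]
    (hPbar : ∀ (n : ℕ) (x : X) (θ : Θ) (A : Set X), MeasurableSet A →
      Pbar n (x, θ) (A ×ˢ Set.univ) = P θ x A)
    -- A1: the function `V` and the set `C`
    (V : X → ℝ) (hV : Measurable V) (hV1 : ∀ x, 1 ≤ V x)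
    (C : Set X) (hC : MeasurableSet C)
    -- A1 (i)
    (r : ℕ → ℝ) (hr_pos : ∀ n, 0 < r n) (hr_mono : Monotone r)
    (hr_sum : Summable fun n => 1 / r n)
    (hr_ret : (⨆ (l : ℕ) (x ∈ C) (θ : Θ),
      ∫⁻ ω, extendRate r (returnTime C ω) ∂chainLaw Pbar l (Measure.dirac (x, θ))) < ∞)
    -- A1 (ii)
    (π : Measure X) [IsProbabilityMeasure π]
    (herg : Tendsto (fun n : ℕ => ⨆ x : X, ENNReal.ofReal (V x)⁻¹ *
      ⨆ θ : Θ, tvNorm ((P θ ^ n) x) π) atTop (𝓝 0))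
    -- A1 (iii)
    (hdrift : ∀ x ∉ C, (⨆ θ : Θ, ∫⁻ y, ENNReal.ofReal (V y) ∂P θ x) ≤ ENNReal.ofReal (V x))
    (hVC : (⨆ (x ∈ C) (θ : Θ),
      ((∫⁻ y, ENNReal.ofReal (V y) ∂P θ x) + ENNReal.ofReal (V x))) < ∞)
    -- B1
    (ξ₁ : Measure X) [IsProbabilityMeasure ξ₁] (ξ₂ : Measure Θ) [IsProbabilityMeasure ξ₂]
    (hB : ∀ ε : ℝ, 0 < ε → Tendsto
      (fun n : ℕ => chainLaw Pbar 0 (ξ₁.prod ξ₂)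
        {ω | ENNReal.ofReal ε ≤ kernelDist P (ω (n + 1)).2 (ω n).2}) atTop (𝓝 0)) :
    Tendsto (fun n : ℕ => ⨆ (f : X → ℝ) (_ : Measurable f) (_ : ∀ x, |f x| ≤ 1),
      ENNReal.ofReal |∫ ω, (f (ω n).1 - ∫ y, f y ∂π) ∂chainLaw Pbar 0 (ξ₁.prod ξ₂)|)
      atTop (𝓝 0) := by
  refine tendsto_iSup_abs_integral hPbar hV1 π herg (ξ₁.prod ξ₂) (fun ε hε => ?_) hB
  set R : ℝ≥0∞ := ⨆ (l : ℕ) (x ∈ C) (θ : Θ),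
      ∫⁻ ω, extendRate r (returnTime C ω) ∂chainLaw Pbar l (Measure.dirac (x, θ)) with hR
  have hS : MeasurableSet (Prod.fst ⁻¹' Cᶜ : Set (X × Θ)) := measurable_fst hC.compl
  have hmV : Measurable fun x => ENNReal.ofReal (V x) := hV.ennreal_ofReal
  have hPV : ∀ l (z : X × Θ), ∫⁻ y, ENNReal.ofReal (V y.1) ∂Pbar l z =
      ∫⁻ y, ENNReal.ofReal (V y) ∂P z.2 z.1 := fun l z => by
    rw [← map_fst_eq hPbar l z, lintegral_map hmV measurable_fst]
  -- Markov's inequality for `r(τ_C)`, uniform over the starting time and the starting point in `C ×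
  -- Θ`; these bounds are summable in `j`.
  have hsurv : ∀ l j, ∀ z ∉ (Prod.fst ⁻¹' Cᶜ : Set (X × Θ)),
      taboo Pbar (Prod.fst ⁻¹' Cᶜ) (fun _ => 1) l j z ≤ R * ENNReal.ofReal (1 / r j) := by
    intro l j z hz
    have hzC : z.1 ∈ C := by simpa using hz
    have hrj := hr_pos j
    rw [one_div, ENNReal.ofReal_inv_of_pos hrj, ← div_eq_mul_inv, ENNReal.le_div_iff_mul_le
      (Or.inl (by simpa using hrj)) (Or.inl ENNReal.ofReal_ne_top),
      taboo_one_eq_lintegral hS, mul_comm]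
    refine (lintegral_const_mul_le _ _).trans
      ((lintegral_mono fun ω => ofReal_mul_prod_le_extendRate hr_mono j ω).trans ?_)
    exact le_iSup_of_le l (le_iSup₂_of_le z.1 hzC (le_iSup_of_le z.2 le_rfl))
  obtain ⟨M, hM⟩ := exists_measure_lt_le (Pbar := Pbar) (ξ₁.prod ξ₂) hS
    (W := fun z => ENNReal.ofReal (V z.1)) (hmV.comp measurable_fst)
    (fun _ => ENNReal.ofReal_ne_top)
    (fun l z hz => by
      rw [hPV]
      exact (le_iSup (fun θ => ∫⁻ y, ENNReal.ofReal (V y) ∂P θ z.1) z.2).trans (hdrift z.1 hz))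
    (fun l z hz => by
      rw [hPV]
      exact le_iSup₂_of_le (f := fun x (_ : x ∈ C) => ⨆ θ : Θ,
        ((∫⁻ y, ENNReal.ofReal (V y) ∂P θ x) + ENNReal.ofReal (V x)))
        z.1 (by simpa using hz) (le_iSup (fun θ =>
          (∫⁻ y, ENNReal.ofReal (V y) ∂P θ z.1) + ENNReal.ofReal (V z.1)) z.2)) hVC.ne hsurv
    (by
      rw [ENNReal.tsum_mul_left]
      exact ENNReal.mul_ne_top hr_ret.ne hr_sum.tsum_ofReal_ne_top) hε
  refine ⟨M, fun n => (measure_mono fun ω hω => ?_).trans (hM n)⟩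
  have hω : (M + 1 : ℝ) < V (ω n).1 := hω
  change ((M + 1 : ℕ) : ℝ≥0∞) < ENNReal.ofReal (V (ω n).1)
  rw [← ENNReal.ofReal_natCast, ENNReal.ofReal_lt_ofReal_iff (by linarith [hV1 (ω n).1])]
  push_cast
  exact hω
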